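/- For an integer $g\ge 0$ let $S_g$ be the closed orientable surface of genus $g$ and $$\pi_1(S_g)=\Big\langle a_1,\dots,a_g,b_1,\dots,b_g\ \Big|\ \prod_{i=1}^g[a_i,b_i]=1\Big\rangle$$ its surface group, where $[a,b]=aba^{-1}b^{-1}$. Let $$1\to\mathbb Z=\langle t\rangle\to G\xrightarrow{f_1}\pi_1(S_g)\to 1$$ be a $\mathbb Z$-central extension, i.e. a short exact sequence of groups in which the image of $\mathbb Z$ lies in the center of $G$. Then $G$ is linear, i.e. it embeds into $\mathrm{GL}(n,F)$ for some field $F$ and some positive integer $n$. Moreover, let $A_i,B_i\in G$ $(1\le i\le g)$ be arbitrary elements with $f_1(A_i)=a_i$ and $f_1(B_i)=b_i$, let $N$ be the normal closure of $\{A_2,\dots,A_g,B_2,\dots,B_g\}$ in $G$, and let $f_2:G\to G/N$ be the quotient map. Then $G/N$ is nilpotent, and the homomorphism $f_1\times f_2:G\to\pi_1(S_g)\times G/N$ is injective. Furthermore, there is $p\in\mathbb Z$ with $\prod_{i=1}^g[A_i,B_i]=t^p$ such that, if $g\ge1$, there is an isomorphism $$G/N\cong\langle x,y,z\mid [x,y]=z^p,\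 [x,z]=[y,z]=1\rangle$$ taking the classes of $A_1,B_1,t$ to $x,y,z$ respectively. -/

import Mathlib

/-- A group `G` is linear if it embeds into `GL(n, F)` for some field `F` and some positive
integer `n`. -/
def IsLinearGroup.{u} (G : Type u) [Group G] : Prop :=
  ∃ (F : Type u) (_ : Field F) (n : ℕ) (φ : G →* GL (Fin n) F), 0 < n ∧ Function.Injective φ

/-- The ordered product of commutators `[A₁, B₁] [A₂, B₂] ⋯ [A_g, B_g]`,
where `[x, y] = x y x⁻¹ y⁻¹`. -/
def commutatorProd {G : Type*} [Group G] {g : ℕ} (A B : Fin g → G) : G :=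
  (List.ofFn fun i => A i * B i * (A i)⁻¹ * (B i)⁻¹).prod

/-- The surface group `π₁(S_g) = ⟨a₁, …, a_g, b₁, …, b_g | [a₁, b₁] ⋯ [a_g, b_g] = 1⟩` of the closed
orientable surface of genus `g`. The generators `aᵢ` are indexed by `Sum.inl`, the generators `bᵢ`
by `Sum.inr`. -/
abbrev SurfaceGroup (g : ℕ) : Type :=
  PresentedGroup
    ({commutatorProd (fun i => FreeGroup.of (Sum.inl i)) (fun i => FreeGroup.of (Sum.inr i))} :
      Set (FreeGroup (Fin g ⊕ Fin g)))

namespace SurfaceGroup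

/-- The generator `aᵢ`. -/
def a {g : ℕ} (i : Fin g) : SurfaceGroup g := PresentedGroup.of (Sum.inl i)

/-- The generator `bᵢ`. -/
def b {g : ℕ} (i : Fin g) : SurfaceGroup g := PresentedGroup.of (Sum.inr i)

end SurfaceGroup

/-- The Heisenberg-type group `⟨x, y, z | [x, y] = z ^ p, [x, z] = [y, z] = 1⟩`, with generators
`x, y, z` indexed by `0, 1, 2`. -/
abbrev HeisenbergType (p : ℤ) : Type :=
  PresentedGroup
    (let x := FreeGroup.of 0
     let y := FreeGroup.of 1
     let z := FreeGroup.of 2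
     {x * y * x⁻¹ * y⁻¹ * (z ^ p)⁻¹, x * z * x⁻¹ * z⁻¹, y * z * y⁻¹ * z⁻¹} :
      Set (FreeGroup (Fin 3)))

/-- The normal closure of `A₂, …, A_g, B₂, …, B_g` (all members of the two families but the first
of each, which has index `0`). -/
def tailClosure {G : Type*} [Group G] {g : ℕ} (A B : Fin g → G) : Subgroup G :=
  Subgroup.normalClosure {x | ∃ i : Fin g, 0 < (i : ℕ) ∧ (x = A i ∨ x = B i)}

instance {G : Type*} [Group G] {g : ℕ} (A B : Fin g → G) : (tailClosure A B).Normal :=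
  Subgroup.normalClosure_normal

/-! The kernel of `f_1` is ⟨t⟩, so `f_1 × f_2` is injective as soon as t keeps infinite order in
G/N. The extension is presented by the lifts and a central t with the single relation ∏[A_i, B_i] =
t^p (`GroupExtension.exists_hom`). For g ≥ 1, killing all handles but the first therefore leaves the
Heisenberg type group (`exists_quotient_equiv`). It embeds into ℤ³ with a twisted product, hence is
nilpotent, has z of infinite order, and has a faithful matrix representation. For g ≤ 1 the subgroup
N is trivial; for g = 0 the group G is ⟨t⟩.

For g ≥ 2, linearity now reduces to that of the surface group. In genus two, π₁ is made of two free
groups of rank two glued along their boundary commutators. Both are represented by the group of a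
modular punctured torus in SL(2, ℤ), whose upper triangular elements are exactly the powers of the
commutator (`mem_zpowers_comm`). The second copy is conjugated by a transvection with a large entry,
which commutes with that commutator. An element outside the boundary subgroup has nonzero lower left
entry, and a valuation argument then shows that an alternating product is never an integer matrix
(`rep_injective`).

Genus m + 2 embeds into genus two as for a cyclic cover; injectivity is read off from an explicit
permutation action on the sheets (`monodromy_coverHom`). -/

/-! ### Heisenberg type groups -/

namespace HeisenbergType

/-- The set `ℤ³` that carries the twisted multiplication
`(a, b, c) (a', b', c') = (a + a', b + b', c + c' + p a b')`. -/
@[ext]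
structure Model (p : ℤ) where
  /-- The exponent of `x`. -/
  a : ℤ
  /-- The exponent of `y`. -/
  b : ℤ
  /-- The exponent of `z`. -/
  c : ℤ

namespace Model

variable {p : ℤ}

instance : Mul (Model p) := ⟨fun u v => ⟨u.a + v.a, u.b + v.b, u.c + v.c + p * u.a * v.b⟩⟩

instance : One (Model p) := ⟨⟨0, 0, 0⟩⟩

instance : Inv (Model p) := ⟨fun u => ⟨-u.a, -u.b, -u.c + p * u.a * u.b⟩⟩

theorem mul_def (u v : Model p) :
    u * v = ⟨u.a + v.a, u.b + v.b, u.c + v.c + p * u.a * v.b⟩ := rfl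

theorem one_def : (1 : Model p) = ⟨0, 0, 0⟩ := rfl

theorem inv_def (u : Model p) : u⁻¹ = ⟨-u.a, -u.b, -u.c + p * u.a * u.b⟩ := rfl

instance : Group (Model p) :=
  Group.ofLeftAxioms
    (fun u v w => by
      ext
      · simp only [mul_def]; ring
      · simp only [mul_def]; ring
      · simp only [mul_def]; ring)
    (fun u => by ext <;> simp [mul_def, one_def])
    (fun u => by ext <;> simp [mul_def, one_def, inv_def])

/-- The projection of the model onto its abelianized first two coordinates. -/
def proj (p : ℤ) : Model p →* Multiplicative (ℤ × ℤ) where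
  toFun u := Multiplicative.ofAdd (u.a, u.b)
  map_one' := rfl
  map_mul' _ _ := rfl

instance : Group.IsNilpotent (Model p) := by
  refine Subgroup.isNilpotent_of_ker_le_center (proj p) (fun u hu => ?_)
  have h : (u.a, u.b) = ((0 : ℤ), (0 : ℤ)) := hu
  obtain ⟨ha, hb⟩ := Prod.mk.inj h
  rw [Subgroup.mem_center_iff]
  intro v
  ext <;> simp [mul_def, ha, hb, add_comm]

/-- The central copy of `ℤ` in the model. -/
def central (p : ℤ) : Multiplicative ℤ →* Model p where
  toFun n := ⟨0, 0, n.toAdd⟩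
  map_one' := rfl
  map_mul' _ _ := by ext <;> simp [mul_def]

theorem central_injective : Function.Injective (central p) := fun _ _ h =>
  Multiplicative.toAdd.injective (congrArg Model.c h)

/-- The representation of the model by unipotent matrices of size four. -/
def toMatrix (p : ℤ) (K : Type*) [Field K] : Model p →* Matrix (Fin 4) (Fin 4) K where
  -- The upper left 3 × 3 block sees `u.a` only through `p * u.a`, which is lost when p = 0; the
  -- last row restores it.
  toFun u := !![1, p * u.a, u.c, 0; 0, 1, u.b, 0; 0, 0, 1, 0; 0, 0, u.a, 1]
  map_one' := by
    ext i j
    fin_cases i <;> fin_cases j <;> simp [one_def]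
  map_mul' u v := by
    ext i j
    fin_cases i <;> fin_cases j <;> simp [mul_def, Matrix.mul_apply, Fin.sum_univ_four] <;> ring

theorem toMatrix_injective {K : Type*} [Field K] [CharZero K] :
    Function.Injective (toMatrix p K) := by
  intro u v h
  have h02 := congrFun (congrFun h 0) 2
  have h12 := congrFun (congrFun h 1) 2
  have h32 := congrFun (congrFun h 3) 2
  simp only [toMatrix, MonoidHom.coe_mk, OneHom.coe_mk, Matrix.of_apply, Matrix.cons_val] at h02 h12 h32
  ext
  · exact_mod_cast h32
  · exact_mod_cast h12
  · exact_mod_cast h02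

end Model

variable {p : ℤ}

section Lift

variable {G : Type*} [Group G]

/-- The homomorphism out of a Heisenberg type group that is given by three elements which satisfy
the defining relations. -/
def lift (x y z : G) (hxy : x * y * x⁻¹ * y⁻¹ = z ^ p) (hxz : Commute x z) (hyz : Commute y z) :
    HeisenbergType p →* G :=
  PresentedGroup.toGroup (f := ![x, y, z]) (by
    rintro r (rfl | rfl | rfl)
    · simp [hxy]
    · simp [hxz.eq]
    · simp [hyz.eq])

variable {x y z : G} {hxy : x * y * x⁻¹ * y⁻¹ = z ^ p} {hxz : Commute x z} {hyz : Commute y z}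

@[simp]
theorem lift_x : lift x y z hxy hxz hyz (PresentedGroup.of 0) = x := PresentedGroup.toGroup.of _

@[simp]
theorem lift_y : lift x y z hxy hxz hyz (PresentedGroup.of 1) = y := PresentedGroup.toGroup.of _

@[simp]
theorem lift_z : lift x y z hxy hxz hyz (PresentedGroup.of 2) = z := PresentedGroup.toGroup.of _

theorem hom_ext {f h : HeisenbergType p →* G}
    (h0 : f (PresentedGroup.of 0) = h (PresentedGroup.of 0))
    (h1 : f (PresentedGroup.of 1) = h (PresentedGroup.of 1))
    (h2 : f (PresentedGroup.of 2) = h (PresentedGroup.of 2)) : f = h :=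
  PresentedGroup.ext fun i => by
    fin_cases i
    exacts [h0, h1, h2]

/-- Moving a power of `x` past a power of `y`. -/
theorem zpow_mul_zpow_comm (hxy : x * y * x⁻¹ * y⁻¹ = z ^ p) (hxz : Commute x z)
    (hyz : Commute y z) (a b : ℤ) : x ^ a * y ^ b = y ^ b * x ^ a * z ^ (p * a * b) := by
  -- Conjugation is a homomorphism and z commutes with x and y, so the case of exponents 1, 1 is
  -- raised to the power a, and then, with the roles of x and y exchanged, to the power b.
  have h1 : y⁻¹ * x * y = x * z ^ p := by
    have : x * y = z ^ p * y * x := by rw [← hxy]; group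
    rw [mul_assoc, this, (hyz.zpow_right p).symm.eq, mul_assoc, inv_mul_cancel_left,
      (hxz.zpow_right p).eq]
  have h2 : y⁻¹ * x ^ a * y = x ^ a * z ^ (p * a) := by
    have := congrArg (· ^ a) h1
    simp only [(hxz.zpow_right p).mul_zpow, ← zpow_mul] at this
    rw [← this]
    simpa using (conj_zpow (a := y⁻¹) (b := x) (i := a)).symm
  have h3 : (x ^ a)⁻¹ * y * x ^ a = y * (z ^ (p * a))⁻¹ := by
    have h4 : x ^ a * y = y * (x ^ a * z ^ (p * a)) := by rw [← h2]; group
    have h5 : y * x ^ a = x ^ a * y * (z ^ (p * a))⁻¹ := by rw [h4]; group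
    rw [mul_assoc, h5]; group
  have h6 : (x ^ a)⁻¹ * y ^ b * x ^ a = y ^ b * (z ^ (p * a * b))⁻¹ := by
    have := congrArg (· ^ b) h3
    simp only [((hyz.zpow_right (p * a)).inv_right).mul_zpow, inv_zpow, ← zpow_mul] at this
    rw [← this]
    simpa using (conj_zpow (a := (x ^ a)⁻¹) (b := y) (i := b)).symm
  have h7 : y ^ b * x ^ a = x ^ a * (y ^ b * (z ^ (p * a * b))⁻¹) := by rw [← h6]; group
  rw [h7]; group

end Lift

local notation "gx" => (PresentedGroup.of 0 : HeisenbergType p)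
local notation "gy" => (PresentedGroup.of 1 : HeisenbergType p)
local notation "gz" => (PresentedGroup.of 2 : HeisenbergType p)

theorem commutator_xy : gx * gy * gx⁻¹ * gy⁻¹ = gz ^ p := by
  rw [← mul_inv_eq_one]
  refine PresentedGroup.one_of_mem (x := FreeGroup.of 0 * FreeGroup.of 1 * (FreeGroup.of 0)⁻¹ *
    (FreeGroup.of 1)⁻¹ * (FreeGroup.of 2 ^ p)⁻¹) ?_
  simp

theorem commute_xz : Commute gx gz := by
  rw [commute_iff_eq, ← mul_inv_eq_one, mul_inv_rev, ← mul_assoc]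
  refine PresentedGroup.one_of_mem (x := FreeGroup.of 0 * FreeGroup.of 2 * (FreeGroup.of 0)⁻¹ *
    (FreeGroup.of 2)⁻¹) ?_
  simp

theorem commute_yz : Commute gy gz := by
  rw [commute_iff_eq, ← mul_inv_eq_one, mul_inv_rev, ← mul_assoc]
  refine PresentedGroup.one_of_mem (x := FreeGroup.of 1 * FreeGroup.of 2 * (FreeGroup.of 1)⁻¹ *
    (FreeGroup.of 2)⁻¹) ?_
  simp

/-- The generator `z` is central. -/
theorem commute_z (w : HeisenbergType p) : Commute w gz := by
  have h : Subgroup.closure (Set.range PresentedGroup.of) ≤ Subgroup.centralizer {gz} := by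
    rw [Subgroup.closure_le]
    rintro _ ⟨i, rfl⟩
    rw [SetLike.mem_coe, Subgroup.mem_centralizer_singleton_iff]
    fin_cases i
    exacts [commute_xz.eq, commute_yz.eq, rfl]
  rw [PresentedGroup.closure_range_of] at h
  exact Subgroup.mem_centralizer_singleton_iff.1 (h (Subgroup.mem_top w))

/-- The presented group maps to the model. -/
def toModel (p : ℤ) : HeisenbergType p →* Model p :=
  lift ⟨1, 0, 0⟩ ⟨0, 1, 0⟩ (Model.central p (Multiplicative.ofAdd 1))
    (by rw [← map_zpow, ← ofAdd_zsmul]; ext <;> simp [Model.mul_def, Model.inv_def, Model.central])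
    (by rw [commute_iff_eq]; ext <;> simp [Model.mul_def, Model.central])
    (by rw [commute_iff_eq]; ext <;> simp [Model.mul_def, Model.central])

theorem toModel_z_zpow (n : ℤ) : toModel p (gz ^ n) = Model.central p (Multiplicative.ofAdd n) := by
  rw [map_zpow, toModel, lift_z, ← map_zpow, ← ofAdd_zsmul, smul_eq_mul, mul_one]

/-- The inverse of `toModel`, which writes an element in the normal form `y ^ b * x ^ a * z ^ c`. -/
def ofModel : Model p →* HeisenbergType p where
  -- With y to the left of x the twisting term vanishes, so `toModel` sends this word to exactly (a,
  -- b, c).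
  toFun u := gy ^ u.b * gx ^ u.a * gz ^ u.c
  map_one' := by simp [Model.one_def]
  map_mul' u v := by
    have hc (w : HeisenbergType p) (n : ℤ) : w * gz ^ n = gz ^ n * w :=
      ((commute_z w).zpow_right n).eq
    have h := zpow_mul_zpow_comm (commutator_xy (p := p)) commute_xz commute_yz u.a v.b
    simp only [Model.mul_def]
    calc gy ^ (u.b + v.b) * gx ^ (u.a + v.a) * gz ^ (u.c + v.c + p * u.a * v.b)
        = gy ^ u.b * (gy ^ v.b * gx ^ u.a * (gx ^ v.a * gz ^ (p * u.a * v.b)))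
            * (gz ^ u.c * gz ^ v.c) := by
          simp only [zpow_add, mul_assoc]
          rw [← mul_assoc (gz ^ u.c) (gz ^ v.c), hc (gz ^ u.c * gz ^ v.c)]
      _ = gy ^ u.b * (gx ^ u.a * gy ^ v.b) * gx ^ v.a * (gz ^ u.c * gz ^ v.c) := by
          rw [h, hc (gx ^ v.a)]; simp only [mul_assoc]
      _ = gy ^ u.b * gx ^ u.a * (gy ^ v.b * gx ^ v.a * gz ^ u.c) * gz ^ v.c := by
          simp only [mul_assoc]
      _ = _ := by rw [hc (gy ^ v.b * gx ^ v.a)]; simp only [mul_assoc]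

theorem toModel_injective : Function.Injective (toModel p) := by
  have h : (ofModel).comp (toModel p) = MonoidHom.id _ := by
    apply hom_ext <;> simp [toModel, ofModel, Model.central]
  exact Function.LeftInverse.injective (g := ofModel) fun w => DFunLike.congr_fun h w

/-- Valid for every p, including 0. This is why t survives in G/N. -/
theorem z_zpow_injective : Function.Injective fun n : ℤ => gz ^ n := by
  intro m n h
  have h' := congrArg (toModel p) h
  simp only [toModel_z_zpow] at h'
  exact Multiplicative.ofAdd.injective (Model.central_injective h')

instance : Group.IsNilpotent (HeisenbergType p) :=
  Group.nilpotent_of_mulEquiv (MonoidHom.ofInjective (toModel_injective (p := p))).symm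

end HeisenbergType

/-! ### Homomorphisms out of surface groups -/

theorem map_commutatorProd {G H : Type*} [Group G] [Group H] (f : G →* H) {g : ℕ}
    (A B : Fin g → G) :
    f (commutatorProd A B) = commutatorProd (fun i => f (A i)) (fun i => f (B i)) := by
  simp only [commutatorProd, map_list_prod, List.map_ofFn]
  congr 2
  funext i
  simp

theorem commutatorProd_succ {G : Type*} [Group G] {g : ℕ} (A B : Fin (g + 1) → G) :
    commutatorProd A B = A 0 * B 0 * (A 0)⁻¹ * (B 0)⁻¹ *
      commutatorProd (fun i => A i.succ) (fun i => B i.succ) := by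
  simp [commutatorProd]

theorem commutatorProd_one {G : Type*} [Group G] {g : ℕ} :
    commutatorProd (fun _ : Fin g => (1 : G)) (fun _ => 1) = 1 := by
  simp [commutatorProd]

/-- The relator of the surface group. -/
def surfaceRelator (g : ℕ) : FreeGroup (Fin g ⊕ Fin g) :=
  commutatorProd (fun i => FreeGroup.of (Sum.inl i)) (fun i => FreeGroup.of (Sum.inr i))

theorem lift_surfaceRelator {G : Type*} [Group G] {g : ℕ} (A B : Fin g → G) :
    FreeGroup.lift (Sum.elim A B) (surfaceRelator g) = commutatorProd A B := by
  simp [surfaceRelator, map_commutatorProd]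

namespace SurfaceGroup

variable {g : ℕ} {G : Type*} [Group G]

/-- The homomorphism out of a surface group that is given by elements which satisfy the defining
relation. -/
def lift (A B : Fin g → G) (h : commutatorProd A B = 1) : SurfaceGroup g →* G :=
  PresentedGroup.toGroup (f := Sum.elim A B) (by
    rintro r rfl
    exact (lift_surfaceRelator A B).trans h)

@[simp]
theorem lift_a (A B : Fin g → G) (h : commutatorProd A B = 1) (i : Fin g) :
    lift A B h (a i) = A i := PresentedGroup.toGroup.of _

@[simp]
theorem lift_b (A B : Fin g → G) (h : commutatorProd A B = 1) (i : Fin g) :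
    lift A B h (b i) = B i := PresentedGroup.toGroup.of _

theorem hom_ext {f h : SurfaceGroup g →* G} (ha : ∀ i, f (a i) = h (a i))
    (hb : ∀ i, f (b i) = h (b i)) : f = h :=
  PresentedGroup.ext fun i => by
    rcases i with i | i
    exacts [ha i, hb i]

theorem commutatorProd_a_b : commutatorProd (a : Fin g → SurfaceGroup g) b = 1 := by
  have h := map_commutatorProd (PresentedGroup.mk {surfaceRelator g})
    (fun i => FreeGroup.of (Sum.inl i)) (fun i => FreeGroup.of (Sum.inr i))
  exact h.symm.trans (PresentedGroup.one_of_mem (Set.mem_singleton (surfaceRelator g)))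

end SurfaceGroup

/-! ### Central extensions of surface groups -/

namespace GroupExtension

variable {g : ℕ} {E : Type*} [Group E] (S : GroupExtension (Multiplicative ℤ) E (SurfaceGroup g))

theorem mem_range_inl_of_rightHom_eq_one {e : E} (he : S.rightHom e = 1) :
    ∃ n : ℤ, e = S.inl (Multiplicative.ofAdd 1) ^ n := by
  have h : e ∈ S.inl.range := by rw [S.range_inl_eq_ker_rightHom]; exact he
  obtain ⟨m, rfl⟩ := h
  refine ⟨m.toAdd, ?_⟩
  rw [← map_zpow, ← ofAdd_zsmul, smul_eq_mul, mul_one, ofAdd_toAdd]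

theorem inl_zpow_injective : Function.Injective fun n : ℤ => S.inl (Multiplicative.ofAdd 1) ^ n := by
  intro m n h
  simp only [← map_zpow, ← ofAdd_zsmul, smul_eq_mul, mul_one] at h
  exact Multiplicative.ofAdd.injective (S.inl_injective h)

theorem commute_inl (hS : S.inl.range ≤ Subgroup.center E) (e : E) (n : Multiplicative ℤ) : Commute e (S.inl n) :=
  Subgroup.mem_center_iff.1 (hS ⟨n, rfl⟩) e

/-- The map onto the extension from the product of a free group and `ℤ` that is given by two
families of elements. -/
def cover (hS : S.inl.range ≤ Subgroup.center E) (A B : Fin g → E) :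
    FreeGroup (Fin g ⊕ Fin g) × Multiplicative ℤ →* E :=
  (FreeGroup.lift (Sum.elim A B)).noncommCoprod S.inl fun _ _ => S.commute_inl hS _ _

theorem rightHom_lift {A B : Fin g → E}
    (hA : ∀ i, S.rightHom (A i) = SurfaceGroup.a i) (hB : ∀ i, S.rightHom (B i) = SurfaceGroup.b i)
    (w : FreeGroup (Fin g ⊕ Fin g)) :
    S.rightHom (FreeGroup.lift (Sum.elim A B) w) = PresentedGroup.mk {surfaceRelator g} w := by
  have h : S.rightHom.comp (FreeGroup.lift (Sum.elim A B)) =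
      PresentedGroup.mk {surfaceRelator g} := by
    ext i
    rcases i with i | i
    · simp only [MonoidHom.comp_apply, FreeGroup.lift_apply_of, Sum.elim_inl]
      exact hA i
    · simp only [MonoidHom.comp_apply, FreeGroup.lift_apply_of, Sum.elim_inr]
      exact hB i
  exact DFunLike.congr_fun h w

theorem cover_surjective (hS : S.inl.range ≤ Subgroup.center E) {A B : Fin g → E}
    (hA : ∀ i, S.rightHom (A i) = SurfaceGroup.a i) (hB : ∀ i, S.rightHom (B i) = SurfaceGroup.b i) : Function.Surjective (S.cover hS A B) := by
  intro e
  obtain ⟨w, hw⟩ := PresentedGroup.mk_surjective {surfaceRelator g} (S.rightHom e)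
  have h : S.rightHom ((FreeGroup.lift (Sum.elim A B) w)⁻¹ * e) = 1 := by
    rw [map_mul, map_inv, S.rightHom_lift hA hB, hw]
    exact inv_mul_cancel _
  obtain ⟨n, hn⟩ := S.mem_range_inl_of_rightHom_eq_one h
  refine ⟨(w, Multiplicative.ofAdd n), ?_⟩
  rw [cover, MonoidHom.noncommCoprod_apply, ← mul_eq_of_eq_inv_mul hn.symm, ← map_zpow, ← ofAdd_zsmul,
    smul_eq_mul, mul_one]

/-- The universal property of a central extension of a surface group by `ℤ`: it is presented by
lifts of the generators and a central element `t`, with the one relation that says which power of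
`t` the product of commutators is. -/
theorem exists_hom (hS : S.inl.range ≤ Subgroup.center E) {A B : Fin g → E}
    (hA : ∀ i, S.rightHom (A i) = SurfaceGroup.a i) (hB : ∀ i, S.rightHom (B i) = SurfaceGroup.b i)
    {p : ℤ} (hp : commutatorProd A B = S.inl (Multiplicative.ofAdd 1) ^ p)
    {H : Type*} [Group H] (X Y : Fin g → H) (z : H) (hz : ∀ w, Commute w z)
    (h : commutatorProd X Y = z ^ p) :
    ∃ φ : E →* H, (∀ i, φ (A i) = X i) ∧ (∀ i, φ (B i) = Y i) ∧
      φ (S.inl (Multiplicative.ofAdd 1)) = z := by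
  set t := S.inl (Multiplicative.ofAdd 1) with ht
  have htc (e : E) (n : ℤ) : Commute e (t ^ n) := (S.commute_inl hS e _).zpow_right n
  -- Words whose two evaluations are the same power of t and of z. They form a normal subgroup
  -- containing the relator, hence all words trivial in the surface group.
  let K : Subgroup (FreeGroup (Fin g ⊕ Fin g)) :=
    { carrier := {w | ∃ m : ℤ, FreeGroup.lift (Sum.elim A B) w = t ^ m ∧
        FreeGroup.lift (Sum.elim X Y) w = z ^ m}
      mul_mem' := by
        rintro u v ⟨m, hm, hm'⟩ ⟨n, hn, hn'⟩
        exact ⟨m + n, by rw [map_mul, hm, hn, zpow_add], by rw [map_mul, hm', hn', zpow_add]⟩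
      one_mem' := ⟨0, by simp, by simp⟩
      inv_mem' := by
        rintro u ⟨m, hm, hm'⟩
        exact ⟨-m, by rw [map_inv, hm, zpow_neg], by rw [map_inv, hm', zpow_neg]⟩ }
  have hK : K.Normal := ⟨by
    rintro u ⟨m, hm, hm'⟩ v
    refine ⟨m, ?_, ?_⟩
    · rw [map_mul, map_mul, map_inv, hm, (htc _ m).eq, mul_inv_cancel_right]
    · rw [map_mul, map_mul, map_inv, hm', ((hz _).zpow_right m).eq, mul_inv_cancel_right]⟩
  have hrel : Subgroup.normalClosure {surfaceRelator g} ≤ K :=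
    Subgroup.normalClosure_le_normal (Set.singleton_subset_iff.2
      ⟨p, by rw [lift_surfaceRelator, hp], by rw [lift_surfaceRelator, h]⟩)
  let ψ : FreeGroup (Fin g ⊕ Fin g) × Multiplicative ℤ →* H :=
    (FreeGroup.lift (Sum.elim X Y)).noncommCoprod (zpowersHom H z) fun _ n =>
      (hz _).zpow_right n.toAdd
  have hψ (w n) : ψ (w, n) = FreeGroup.lift (Sum.elim X Y) w * z ^ n.toAdd := rfl
  have hker : (S.cover hS A B).ker ≤ ψ.ker := by
    rintro ⟨w, n⟩ hw
    rw [MonoidHom.mem_ker, cover, MonoidHom.noncommCoprod_apply] at hw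
    have hw1 : PresentedGroup.mk {surfaceRelator g} w = 1 := by
      have := congrArg S.rightHom hw
      rw [map_mul, S.rightHom_inl, mul_one, map_one] at this
      exact (S.rightHom_lift hA hB w).symm.trans this
    obtain ⟨m, hm, hm'⟩ := hrel (PresentedGroup.mk_eq_one_iff.1 hw1)
    have hn : S.inl n = t ^ n.toAdd := by
      rw [ht, ← map_zpow, ← ofAdd_zsmul, smul_eq_mul, mul_one, ofAdd_toAdd]
    dsimp only at hw hm hm'
    rw [hm, hn, ← zpow_add] at hw
    have hmn : m + n.toAdd = 0 := S.inl_zpow_injective (by simpa using hw)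
    rw [MonoidHom.mem_ker, hψ, hm', ← zpow_add, hmn, zpow_zero]
  have hcov := S.cover_surjective hS hA hB
  let φ : E →* H := (S.cover hS A B).liftOfSurjective hcov ⟨ψ, hker⟩
  have hφ (u) : φ (S.cover hS A B u) = ψ u :=
    MonoidHom.liftOfRightInverse_comp_apply _ _ (Function.rightInverse_surjInv hcov) ⟨ψ, hker⟩ u
  refine ⟨φ, fun i => ?_, fun i => ?_, ?_⟩
  · simpa [cover, hψ] using hφ (FreeGroup.of (Sum.inl i), 1)
  · simpa [cover, hψ] using hφ (FreeGroup.of (Sum.inr i), 1)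
  · simpa [cover, hψ] using hφ (1, Multiplicative.ofAdd 1)

/-- Homomorphisms out of the extension are determined by the lifts of the generators and `t`. -/
theorem hom_ext (hS : S.inl.range ≤ Subgroup.center E) {A B : Fin g → E}
    (hA : ∀ i, S.rightHom (A i) = SurfaceGroup.a i) (hB : ∀ i, S.rightHom (B i) = SurfaceGroup.b i)
    {H : Type*} [Group H] {φ ψ : E →* H} (h1 : ∀ i, φ (A i) = ψ (A i))
    (h2 : ∀ i, φ (B i) = ψ (B i))
    (h3 : φ (S.inl (Multiplicative.ofAdd 1)) = ψ (S.inl (Multiplicative.ofAdd 1))) : φ = ψ := by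
  have hl : φ.comp (FreeGroup.lift (Sum.elim A B)) = ψ.comp (FreeGroup.lift (Sum.elim A B)) := by
    ext i
    rcases i with i | i
    · simpa using h1 i
    · simpa using h2 i
  have hr : φ.comp S.inl = ψ.comp S.inl := by
    ext
    simpa using h3
  ext e
  obtain ⟨⟨w, n⟩, rfl⟩ := S.cover_surjective hS hA hB e
  rw [cover, MonoidHom.noncommCoprod_apply, map_mul, map_mul]
  exact congrArg₂ (· * ·) (DFunLike.congr_fun hl w) (DFunLike.congr_fun hr n)

theorem exists_commutatorProd_eq_zpow {A B : Fin g → E}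
    (hA : ∀ i, S.rightHom (A i) = SurfaceGroup.a i) (hB : ∀ i, S.rightHom (B i) = SurfaceGroup.b i) :
    ∃ p : ℤ, commutatorProd A B = S.inl (Multiplicative.ofAdd 1) ^ p := by
  apply S.mem_range_inl_of_rightHom_eq_one
  rw [map_commutatorProd]
  simp only [hA, hB]
  exact SurfaceGroup.commutatorProd_a_b

/-- The quotient by the normal closure of all generators but the first two is of Heisenberg
type. -/
theorem exists_quotient_equiv (hS : S.inl.range ≤ Subgroup.center E) {A B : Fin g → E}
    (hA : ∀ i, S.rightHom (A i) = SurfaceGroup.a i) (hB : ∀ i, S.rightHom (B i) = SurfaceGroup.b i)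
    {p : ℤ}
    (hp : commutatorProd A B = S.inl (Multiplicative.ofAdd 1) ^ p) (hg : 0 < g) :
    ∃ e : E ⧸ tailClosure A B ≃* HeisenbergType p,
      e (QuotientGroup.mk (A ⟨0, hg⟩)) = PresentedGroup.of 0 ∧
      e (QuotientGroup.mk (B ⟨0, hg⟩)) = PresentedGroup.of 1 ∧
      e (QuotientGroup.mk (S.inl (Multiplicative.ofAdd 1))) = PresentedGroup.of 2 := by
  obtain ⟨k, rfl⟩ : ∃ k, g = k + 1 := ⟨g - 1, by omega⟩
  change ∃ e : E ⧸ tailClosure A B ≃* HeisenbergType p,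
      e (QuotientGroup.mk (A 0)) = PresentedGroup.of 0 ∧
      e (QuotientGroup.mk (B 0)) = PresentedGroup.of 1 ∧
      e (QuotientGroup.mk (S.inl (Multiplicative.ofAdd 1))) = PresentedGroup.of 2
  -- The first handle goes to x, y and all others to 1, so the relation to be checked is just [x, y]
  -- = z^p.
  obtain ⟨φ, hφA, hφB, hφt⟩ := S.exists_hom hS hA hB hp
    (H := HeisenbergType p) (Fin.cons (PresentedGroup.of 0) fun _ => 1)
    (Fin.cons (PresentedGroup.of 1) fun _ => 1) (PresentedGroup.of 2) HeisenbergType.commute_z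
    (by
      rw [commutatorProd_succ]
      simp only [Fin.cons_zero, Fin.cons_succ, commutatorProd_one, mul_one]
      exact HeisenbergType.commutator_xy)
  have hmkA (i : Fin k) : (QuotientGroup.mk (A i.succ) : E ⧸ tailClosure A B) = 1 :=
    (QuotientGroup.eq_one_iff _).2
      (Subgroup.subset_normalClosure ⟨i.succ, by simp, Or.inl rfl⟩)
  have hmkB (i : Fin k) : (QuotientGroup.mk (B i.succ) : E ⧸ tailClosure A B) = 1 :=
    (QuotientGroup.eq_one_iff _).2
      (Subgroup.subset_normalClosure ⟨i.succ, by simp, Or.inr rfl⟩)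
  have hφN : tailClosure A B ≤ φ.ker := by
    refine Subgroup.normalClosure_le_normal ?_
    rintro _ ⟨i, hi, rfl | rfl⟩
    all_goals
      obtain ⟨j, rfl⟩ := Fin.exists_succ_eq.2 (show i ≠ 0 by rintro rfl; simp at hi)
      simp [MonoidHom.mem_ker, hφA, hφB]
  let f : E ⧸ tailClosure A B →* HeisenbergType p := QuotientGroup.lift _ φ hφN
  let π := QuotientGroup.mk' (tailClosure A B)
  let h : HeisenbergType p →* E ⧸ tailClosure A B :=
    HeisenbergType.lift (π (A 0)) (π (B 0)) (π (S.inl (Multiplicative.ofAdd 1)))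
      (by
        have := congrArg π hp
        rw [map_commutatorProd, commutatorProd_succ, map_zpow] at this
        rw [← this]
        simp [π, hmkA, hmkB, commutatorProd_one])
      ((S.commute_inl hS _ _).map π) ((S.commute_inl hS _ _).map π)
  have hfh : f.comp h = MonoidHom.id _ := by
    apply HeisenbergType.hom_ext <;> simp [f, h, π, hφA, hφB, hφt]
  have hhf : h.comp f = MonoidHom.id _ := by
    apply QuotientGroup.monoidHom_ext
    refine S.hom_ext hS hA hB (fun i => ?_) (fun i => ?_) ?_
    · refine Fin.cases ?_ (fun i => ?_) i <;> simp [f, h, π, hφA, hmkA]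
    · refine Fin.cases ?_ (fun i => ?_) i <;> simp [f, h, π, hφB, hmkB]
    · simp [f, h, π, hφt]
  refine ⟨f.toMulEquiv h hhf hfh, ?_, ?_, ?_⟩ <;> simp [f, hφA, hφB, hφt]

/-- No index is positive here. In genus zero this gives injectivity of the product map; in genus one
it makes the Heisenberg representation alone faithful. -/
theorem tailClosure_eq_bot (hg : g ≤ 1) (A B : Fin g → E) : tailClosure A B = ⊥ := by
  rw [tailClosure, Subgroup.normalClosure_eq_bot_iff]
  rintro _ ⟨i, hi, _⟩
  omega

/-- The surface group and the quotient of Heisenberg type separate the points. -/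
theorem prod_injective (hS : S.inl.range ≤ Subgroup.center E) {A B : Fin g → E}
    (hA : ∀ i, S.rightHom (A i) = SurfaceGroup.a i) (hB : ∀ i, S.rightHom (B i) = SurfaceGroup.b i) :
    Function.Injective (S.rightHom.prod (QuotientGroup.mk' (tailClosure A B))) := by
  rw [injective_iff_map_eq_one]
  intro e he
  obtain ⟨h1, h2⟩ := Prod.mk.inj he
  rcases Nat.eq_zero_or_pos g with hg | hg
  · have h3 := (QuotientGroup.eq_one_iff e).1 h2
    rwa [tailClosure_eq_bot (by omega), Subgroup.mem_bot] at h3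
  · obtain ⟨n, rfl⟩ := S.mem_range_inl_of_rightHom_eq_one h1
    obtain ⟨p, hp⟩ := S.exists_commutatorProd_eq_zpow hA hB
    obtain ⟨f, -, -, hf⟩ := S.exists_quotient_equiv hS hA hB hp hg
    have h3 := congrArg f h2
    rw [map_zpow (QuotientGroup.mk' (tailClosure A B)), map_zpow f, map_one f] at h3
    have h4 : n = 0 := HeisenbergType.z_zpow_injective (p := p) (by
      change (PresentedGroup.of 2 : HeisenbergType p) ^ n = PresentedGroup.of 2 ^ (0 : ℤ)
      rw [zpow_zero, ← hf]
      exact h3)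
    rw [h4, zpow_zero]

end GroupExtension

/-! ### The modular punctured torus

Two matrices in `SL(2, ℤ)` freely generate a group in which the upper triangular matrices are the
powers of the commutator of the generators. -/

namespace ModularTorus

open Matrix MatrixGroups

/-- The first generator. -/
def matX : SL(2, ℤ) := ⟨!![2, -1; -1, 1], by simp [Matrix.det_fin_two]⟩

/-- The second generator. -/
def matY : SL(2, ℤ) := ⟨!![2, 1; 1, 1], by simp [Matrix.det_fin_two]⟩

/-- The representation of the free group of rank two. -/
def rho : FreeGroup (Fin 2) →* SL(2, ℤ) := FreeGroup.lift ![matX, matY]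

theorem rho_zero : rho (FreeGroup.of 0) = matX := by simp [rho]

theorem rho_one : rho (FreeGroup.of 1) = matY := by simp [rho]

theorem coe_matX : (matX : Matrix (Fin 2) (Fin 2) ℤ) = !![2, -1; -1, 1] := rfl

theorem coe_matX_inv : ((matX⁻¹ : SL(2, ℤ)) : Matrix (Fin 2) (Fin 2) ℤ) = !![1, 1; 1, 2] := by
  rw [Matrix.SpecialLinearGroup.coe_inv, coe_matX, adjugate_fin_two_of, neg_neg]

theorem coe_matY : (matY : Matrix (Fin 2) (Fin 2) ℤ) = !![2, 1; 1, 1] := rfl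

theorem coe_matY_inv : ((matY⁻¹ : SL(2, ℤ)) : Matrix (Fin 2) (Fin 2) ℤ) = !![1, -1; -1, 2] := by
  rw [Matrix.SpecialLinearGroup.coe_inv, coe_matY, adjugate_fin_two_of]

theorem matX_mul (M : SL(2, ℤ)) (j : Fin 2) :
    (matX * M) 0 j = 2 * M 0 j - M 1 j ∧ (matX * M) 1 j = -M 0 j + M 1 j := by
  rw [Matrix.SpecialLinearGroup.coe_mul, coe_matX]
  simp [mul_apply, Fin.sum_univ_two, sub_eq_add_neg]

theorem matX_inv_mul (M : SL(2, ℤ)) (j : Fin 2) :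
    (matX⁻¹ * M) 0 j = M 0 j + M 1 j ∧ (matX⁻¹ * M) 1 j = M 0 j + 2 * M 1 j := by
  rw [Matrix.SpecialLinearGroup.coe_mul, coe_matX_inv]
  simp [mul_apply, Fin.sum_univ_two]

theorem matY_mul (M : SL(2, ℤ)) (j : Fin 2) :
    (matY * M) 0 j = 2 * M 0 j + M 1 j ∧ (matY * M) 1 j = M 0 j + M 1 j := by
  rw [Matrix.SpecialLinearGroup.coe_mul, coe_matY]
  simp [mul_apply, Fin.sum_univ_two]

theorem matY_inv_mul (M : SL(2, ℤ)) (j : Fin 2) :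
    (matY⁻¹ * M) 0 j = M 0 j - M 1 j ∧ (matY⁻¹ * M) 1 j = -M 0 j + 2 * M 1 j := by
  rw [Matrix.SpecialLinearGroup.coe_mul, coe_matY_inv]
  simp [mul_apply, Fin.sum_univ_two, sub_eq_add_neg]

theorem column_ne_zero (M : SL(2, ℤ)) : M 0 0 ≠ 0 ∨ M 1 0 ≠ 0 := by
  by_contra! h
  have := M.det_coe
  rw [Matrix.det_fin_two, h.1, h.2] at this
  simp at this

/-- The arc of the projective line into which the `i`-th generator attracts: `[∞, -1)` for the
first generator, `[1, ∞)` for the second one. -/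
def forwardArc : Fin 2 → Set SL(2, ℤ) :=
  ![{M | M 1 0 = 0 ∨ (0 < M 1 0 ∧ M 0 0 < -M 1 0) ∨ (M 1 0 < 0 ∧ -M 1 0 < M 0 0)},
    {M | (0 < M 1 0 ∧ M 1 0 ≤ M 0 0) ∨ (M 1 0 < 0 ∧ M 0 0 ≤ M 1 0)}]

/-- The arc of the projective line into which the inverse of the `i`-th generator attracts: `[0, 1)`
for the first generator, `[-1, 0)` for the second one. -/
def backwardArc : Fin 2 → Set SL(2, ℤ) :=
  ![{M | (0 < M 1 0 ∧ 0 ≤ M 0 0 ∧ M 0 0 < M 1 0) ∨ (M 1 0 < 0 ∧ M 0 0 ≤ 0 ∧ M 1 0 < M 0 0)},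
    {M | (0 < M 1 0 ∧ -M 1 0 ≤ M 0 0 ∧ M 0 0 < 0) ∨ (M 1 0 < 0 ∧ 0 < M 0 0 ∧ M 0 0 ≤ -M 1 0)}]

/-- Ping-pong on first columns, read as points M 0 0 / M 1 0 of the projective line up to sign. The
four arcs tile the whole circle and meet at their endpoints, so they are taken half-open to be
disjoint. -/
theorem rho_injective : Function.Injective rho := by
  refine FreeGroup.injective_lift_of_ping_pong ![matX, matY] forwardArc backwardArc ?_ ?_ ?_ ?_ ?_ ?_
  · intro i
    fin_cases i
    · exact ⟨1, Or.inl (by simp)⟩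
    · exact ⟨matY, Or.inl (by simp [matY])⟩
  · intro i j hij
    rw [Function.onFun, Set.disjoint_left]
    intro M
    fin_cases i <;> fin_cases j <;> simp [forwardArc] at hij ⊢ <;> omega
  · intro i j hij
    rw [Function.onFun, Set.disjoint_left]
    intro M
    fin_cases i <;> fin_cases j <;> simp [backwardArc] at hij ⊢ <;> omega
  · intro i j
    rw [Set.disjoint_left]
    intro M
    fin_cases i <;> fin_cases j <;> simp [forwardArc, backwardArc] <;> omega
  · intro i
    rintro _ ⟨M, hM, rfl⟩
    have h0 := column_ne_zero M
    have hX := matX_mul M 0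
    have hY := matY_mul M 0
    fin_cases i <;>
      simp [forwardArc, backwardArc, -Matrix.SpecialLinearGroup.coe_mul] at hM ⊢ <;> omega
  · intro i
    rintro _ ⟨M, hM, rfl⟩
    have h0 := column_ne_zero M
    have hX := matX_inv_mul M 0
    have hY := matY_inv_mul M 0
    fin_cases i <;>
      simp [forwardArc, backwardArc, -Matrix.SpecialLinearGroup.coe_mul] at hM ⊢ <;> omega

/-- Induction over the matrices in the image of the representation. -/
theorem rho_induction {P : SL(2, ℤ) → Prop} (one : P 1) (hX : ∀ M, P M → P (matX * M))
    (hX' : ∀ M, P M → P (matX⁻¹ * M)) (hY : ∀ M, P M → P (matY * M))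
    (hY' : ∀ M, P M → P (matY⁻¹ * M)) (w : FreeGroup (Fin 2)) : P (rho w) := by
  have hw : w ∈ Subgroup.closure (Set.range FreeGroup.of) := by
    rw [FreeGroup.closure_range_of]; trivial
  induction hw using Subgroup.closure_induction_left with
  | one => simpa using one
  | mul_left x hx y hy ih =>
    obtain ⟨i, rfl⟩ := hx
    rw [map_mul]
    fin_cases i
    · simpa [rho_zero] using hX _ ih
    · simpa [rho_one] using hY _ ih
  | inv_mul_cancel x hx y hy ih =>
    obtain ⟨i, rfl⟩ := hx
    rw [map_mul, map_inv]
    fin_cases i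
    · simpa [rho_zero] using hX' _ ih
    · simpa [rho_one] using hY' _ ih

/-- Modulo three, the image of the representation is a quaternion group. -/
theorem rho_mod_three (w : FreeGroup (Fin 2)) :
    ((rho w 0 0 : ZMod 3) = -rho w 1 1) ∨ ((rho w 0 1 : ZMod 3) = 0 ∧ (rho w 1 0 : ZMod 3) = 0) := by
  have key : ∀ a b c d : ZMod 3, a * d - b * c = 1 → (a = -d ∨ (b = 0 ∧ c = 0)) →
      (2 * a - c = -(-b + d) ∨ (2 * b - d = 0 ∧ -a + c = 0)) ∧
      (a + c = -(b + 2 * d) ∨ (b + d = 0 ∧ a + 2 * c = 0)) ∧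
      (2 * a + c = -(b + d) ∨ (2 * b + d = 0 ∧ a + c = 0)) ∧
      (a - c = -(-b + 2 * d) ∨ (b - d = 0 ∧ -a + 2 * c = 0)) := by decide
  have hdet (M : SL(2, ℤ)) : (M 0 0 : ZMod 3) * M 1 1 - M 0 1 * M 1 0 = 1 := by
    have := M.det_coe
    rw [Matrix.det_fin_two] at this
    exact_mod_cast congrArg (Int.cast : ℤ → ZMod 3) this
  refine rho_induction (P := fun M => ((M 0 0 : ZMod 3) = -M 1 1) ∨
    ((M 0 1 : ZMod 3) = 0 ∧ (M 1 0 : ZMod 3) = 0)) (by simp) ?_ ?_ ?_ ?_ w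
  · intro M hM
    simp only [matX_mul]
    push_cast
    exact (key _ _ _ _ (hdet M) hM).1
  · intro M hM
    simp only [matX_inv_mul]
    push_cast
    exact (key _ _ _ _ (hdet M) hM).2.1
  · intro M hM
    simp only [matY_mul]
    push_cast
    exact (key _ _ _ _ (hdet M) hM).2.2.1
  · intro M hM
    simp only [matY_inv_mul]
    push_cast
    exact (key _ _ _ _ (hdet M) hM).2.2.2

/-- The commutator subgroup of `SL(2, ℤ/4)`, a group of order twelve. -/
def modFourImage : List (ZMod 4 × ZMod 4 × ZMod 4 × ZMod 4) :=
  [(0, 1, 3, 3), (0, 3, 1, 3), (1, 0, 0, 1), (1, 1, 1, 2), (1, 2, 2, 1), (1, 3, 3, 2),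
    (2, 1, 1, 1), (2, 3, 3, 1), (3, 0, 2, 3), (3, 1, 3, 0), (3, 2, 0, 3), (3, 3, 1, 0)]

theorem rho_mod_four (w : FreeGroup (Fin 2)) :
    ((rho w 0 0 : ZMod 4), (rho w 0 1 : ZMod 4), (rho w 1 0 : ZMod 4), (rho w 1 1 : ZMod 4)) ∈
      modFourImage := by
  have key : ∀ m ∈ modFourImage,
      (2 * m.1 - m.2.2.1, 2 * m.2.1 - m.2.2.2, -m.1 + m.2.2.1, -m.2.1 + m.2.2.2) ∈ modFourImage ∧
      (m.1 + m.2.2.1, m.2.1 + m.2.2.2, m.1 + 2 * m.2.2.1, m.2.1 + 2 * m.2.2.2) ∈ modFourImage ∧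
      (2 * m.1 + m.2.2.1, 2 * m.2.1 + m.2.2.2, m.1 + m.2.2.1, m.2.1 + m.2.2.2) ∈ modFourImage ∧
      (m.1 - m.2.2.1, m.2.1 - m.2.2.2, -m.1 + 2 * m.2.2.1, -m.2.1 + 2 * m.2.2.2) ∈
        modFourImage := by decide
  refine rho_induction (P := fun M => ((M 0 0 : ZMod 4), (M 0 1 : ZMod 4), (M 1 0 : ZMod 4),
    (M 1 1 : ZMod 4)) ∈ modFourImage) (by simp [modFourImage]) ?_ ?_ ?_ ?_ w
  · intro M hM
    simp only [matX_mul]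
    push_cast
    exact (key _ hM).1
  · intro M hM
    simp only [matX_inv_mul]
    push_cast
    exact (key _ hM).2.1
  · intro M hM
    simp only [matY_mul]
    push_cast
    exact (key _ hM).2.2.1
  · intro M hM
    simp only [matY_inv_mul]
    push_cast
    exact (key _ hM).2.2.2

/-- The commutator of the two free generators. -/
def commXY : FreeGroup (Fin 2) :=
  FreeGroup.of 0 * FreeGroup.of 1 * (FreeGroup.of 0)⁻¹ * (FreeGroup.of 1)⁻¹

theorem rho_comm : (rho commXY : Matrix (Fin 2) (Fin 2) ℤ) = !![-1, 6; 0, -1] := by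
  simp only [commXY, map_mul, map_inv, rho_zero, rho_one, Matrix.SpecialLinearGroup.coe_mul, coe_matX,
    coe_matX_inv, coe_matY, coe_matY_inv]
  simp

theorem rho_comm_inv :
    ((rho commXY)⁻¹ : SL(2, ℤ)).1 = !![-1, -6; 0, -1] := by
  rw [Matrix.SpecialLinearGroup.coe_inv, rho_comm, adjugate_fin_two_of, neg_zero]

/-- Trace 2 is nonzero modulo 3, so the quaternion condition forces 3 ∣ b for the upper right entry
b. Modulo 4 the only unipotent upper triangular matrix in the list is the identity, so 4 ∣ b. The
squared commutator is translation by −12, which accounts for all multiples of 12. -/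
theorem mem_zpowers_comm_of_unipotent {w : FreeGroup (Fin 2)} (hw : rho w 1 0 = 0)
    (h00 : rho w 0 0 = 1) : w ∈ Subgroup.zpowers commXY := by
  have h11 : rho w 1 1 = 1 := by
    have hdet := (rho w).det_coe
    rwa [det_fin_two, hw, mul_zero, sub_zero, h00, one_mul] at hdet
  have h3 : (3 : ℤ) ∣ rho w 0 1 := by
    have h := rho_mod_three w
    rw [h00, h11] at h
    rcases h with h | h
    · exact absurd h (by decide)
    · exact (ZMod.intCast_zmod_eq_zero_iff_dvd _ 3).1 h.1
  have h4 : (4 : ℤ) ∣ rho w 0 1 := by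
    have h := rho_mod_four w
    rw [h00, h11, hw] at h
    have key : ∀ b : ZMod 4, (((1 : ℤ) : ZMod 4), b, ((0 : ℤ) : ZMod 4), ((1 : ℤ) : ZMod 4)) ∈
      modFourImage → b = 0 := by decide
    exact (ZMod.intCast_zmod_eq_zero_iff_dvd _ 4).1 (key _ h)
  obtain ⟨m, hm⟩ : (12 : ℤ) ∣ rho w 0 1 := by omega
  have hT : rho commXY ^ 2 = ModularGroup.T ^ (-12 : ℤ) := by
    ext i j
    rw [ModularGroup.coe_T_zpow, Matrix.SpecialLinearGroup.coe_pow, rho_comm, pow_two]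
    fin_cases i <;> fin_cases j <;> simp
  refine ⟨2 * -m, rho_injective ?_⟩
  change rho (commXY ^ (2 * -m)) = rho w
  rw [map_zpow, _root_.zpow_mul, zpow_ofNat, hT, ← _root_.zpow_mul]
  ext i j
  rw [ModularGroup.coe_T_zpow]
  fin_cases i <;> fin_cases j <;> simp [hw, h00, h11, hm]

/-- An element of the free group with upper triangular image is a power of the commutator. -/
theorem mem_zpowers_comm {w : FreeGroup (Fin 2)} (hw : rho w 1 0 = 0) :
    w ∈ Subgroup.zpowers commXY := by
  have hdet := (rho w).det_coe
  rw [det_fin_two, hw, mul_zero, sub_zero] at hdet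
  rcases Int.eq_one_or_neg_one_of_mul_eq_one hdet with h | h
  · exact mem_zpowers_comm_of_unipotent hw h
  -- The commutator also has diagonal −1, so dividing by it reduces to the unipotent case.
  · have h' : w * commXY⁻¹ ∈ Subgroup.zpowers commXY := by
      apply mem_zpowers_comm_of_unipotent <;>
      · rw [map_mul, map_inv, Matrix.SpecialLinearGroup.coe_mul]
        rw [rho_comm_inv]
        simp [mul_apply, Fin.sum_univ_two, hw, h]
    simpa using mul_mem h' (Subgroup.mem_zpowers commXY)

end ModularTorus

/-! ### The surface group of genus two is linear -/

namespace GenusTwo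

open Matrix MatrixGroups ModularTorus

/-! ### Words in the two handles. -/

/-- The first handle of the surface of genus two. -/
def leftHandle : FreeGroup (Fin 2) →* SurfaceGroup 2 :=
  FreeGroup.lift ![SurfaceGroup.a 0, SurfaceGroup.b 0]

/-- The second handle of the surface of genus two, with the two generators swapped. -/
def rightHandle : FreeGroup (Fin 2) →* SurfaceGroup 2 :=
  FreeGroup.lift ![SurfaceGroup.b 1, SurfaceGroup.a 1]

/-- Swapping the generators of the second handle inverts its commutator, so the surface relation
identifies the two boundary elements. -/
theorem handle_comm : rightHandle commXY = leftHandle commXY := by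
  have h := SurfaceGroup.commutatorProd_a_b (g := 2)
  simp only [commutatorProd, List.ofFn_succ, List.ofFn_zero, List.prod_cons, List.prod_nil,
    mul_one] at h
  rw [← mul_inv_eq_one] at h ⊢
  rw [← inv_eq_one]
  simpa [commXY, leftHandle, rightHandle, mul_assoc] using h

theorem handle_eq_of_mem {w : FreeGroup (Fin 2)} (hw : rho w 1 0 = 0) :
    rightHandle w = leftHandle w := by
  obtain ⟨k, rfl⟩ := mem_zpowers_comm hw
  simp only [map_zpow, handle_comm]

/-- Alternating products of elements of the two handles, none of which is peripheral, that begin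
and end in the second handle. -/
inductive Alternating : SurfaceGroup 2 → Prop
  | base (v : FreeGroup (Fin 2)) : rho v 1 0 ≠ 0 → Alternating (rightHandle v)
  | step (v u : FreeGroup (Fin 2)) (h : SurfaceGroup 2) : rho v 1 0 ≠ 0 → rho u 1 0 ≠ 0 →
      Alternating h → Alternating (rightHandle v * leftHandle u * h)

/-- Elements of the first handle and alternating products padded by such elements. -/
def Reduced (x : SurfaceGroup 2) : Prop :=
  (∃ u, x = leftHandle u) ∨ ∃ u h u', Alternating h ∧ x = leftHandle u * h * leftHandle u'

theorem Reduced.left_mul {x : SurfaceGroup 2} (hx : Reduced x) (w : FreeGroup (Fin 2)) :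
    Reduced (leftHandle w * x) := by
  rcases hx with ⟨u, rfl⟩ | ⟨u, h, u', hh, rfl⟩
  · exact Or.inl ⟨w * u, (map_mul _ _ _).symm⟩
  · exact Or.inr ⟨w * u, h, u', hh, by simp only [map_mul, mul_assoc]⟩

theorem Reduced.mul_left {x : SurfaceGroup 2} (hx : Reduced x) (w : FreeGroup (Fin 2)) :
    Reduced (x * leftHandle w) := by
  rcases hx with ⟨u, rfl⟩ | ⟨u, h, u', hh, rfl⟩
  · exact Or.inl ⟨u * w, (map_mul _ _ _).symm⟩
  · exact Or.inr ⟨u, h, u' * w, hh, by simp only [map_mul, mul_assoc]⟩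

theorem Alternating.reduced {h : SurfaceGroup 2} (hh : Alternating h) : Reduced h :=
  Or.inr ⟨1, h, 1, hh, by simp⟩

theorem reduced_rightHandle (w : FreeGroup (Fin 2)) : Reduced (rightHandle w) := by
  by_cases hw : rho w 1 0 = 0
  · exact Or.inl ⟨w, handle_eq_of_mem hw⟩
  · exact (Alternating.base w hw).reduced

theorem Alternating.right_mul {h : SurfaceGroup 2} (hh : Alternating h) (w : FreeGroup (Fin 2)) :
    Reduced (rightHandle w * h) := by
  cases hh with
  | base v hv =>
    rw [← map_mul]
    exact reduced_rightHandle _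
  | step v u h hv hu hh =>
    rw [← mul_assoc, ← mul_assoc, ← map_mul]
    by_cases hw : rho (w * v) 1 0 = 0
    · rw [handle_eq_of_mem hw, mul_assoc]
      exact (hh.reduced.left_mul u).left_mul _
    · exact (Alternating.step _ u h hw hu hh).reduced

theorem Reduced.right_mul {x : SurfaceGroup 2} (hx : Reduced x) (w : FreeGroup (Fin 2)) :
    Reduced (rightHandle w * x) := by
  rcases hx with ⟨u, rfl⟩ | ⟨u, h, u', hh, rfl⟩
  · exact (reduced_rightHandle w).mul_left u
  · rw [← mul_assoc]
    apply Reduced.mul_left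
    by_cases hu : rho u 1 0 = 0
    · rw [← handle_eq_of_mem hu, ← mul_assoc, ← map_mul]
      exact hh.right_mul _
    · by_cases hw : rho w 1 0 = 0
      · rw [handle_eq_of_mem hw]
        exact (hh.reduced.left_mul u).left_mul w
      · rw [← mul_assoc]
        exact (Alternating.step w u h hw hu hh).reduced

/-- Reduced elements are stable under left multiplication by both handles, which generate. Only
existence of the form is needed: uniqueness is replaced by the valuation argument. -/
theorem reduced (x : SurfaceGroup 2) : Reduced x := by
  have hgen (i : Fin 2 ⊕ Fin 2) : (∃ u, PresentedGroup.of i = leftHandle u) ∨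
      ∃ u, PresentedGroup.of i = rightHandle u := by
    rcases i with i | i <;> fin_cases i
    · exact Or.inl ⟨FreeGroup.of 0, by simp [leftHandle, SurfaceGroup.a]⟩
    · exact Or.inr ⟨FreeGroup.of 1, by simp [rightHandle, SurfaceGroup.a]⟩
    · exact Or.inl ⟨FreeGroup.of 1, by simp [leftHandle, SurfaceGroup.b]⟩
    · exact Or.inr ⟨FreeGroup.of 0, by simp [rightHandle, SurfaceGroup.b]⟩
  have hx : x ∈ Subgroup.closure (Set.range PresentedGroup.of) := by
    rw [PresentedGroup.closure_range_of]; trivial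
  induction hx using Subgroup.closure_induction_left with
  | one => exact Or.inl ⟨1, (map_one _).symm⟩
  | mul_left x hx y hy ih =>
    obtain ⟨i, rfl⟩ := hx
    rcases hgen i with ⟨u, hu⟩ | ⟨u, hu⟩ <;> rw [hu]
    exacts [ih.left_mul u, ih.right_mul u]
  | inv_mul_cancel x hx y hy ih =>
    obtain ⟨i, rfl⟩ := hx
    rcases hgen i with ⟨u, hu⟩ | ⟨u, hu⟩ <;> rw [hu, ← map_inv]
    exacts [ih.left_mul _, ih.right_mul _]

/-! ### The twisted representation and the valuation argument. -/

section Representation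

variable {L : Type*} [Field L]

/-- The representation of the first handle. -/
def leftRep (L : Type*) [Field L] : FreeGroup (Fin 2) →* SL(2, L) :=
  (Matrix.SpecialLinearGroup.map (Int.castRingHom L)).comp rho

theorem leftRep_apply (w : FreeGroup (Fin 2)) (i j : Fin 2) :
    leftRep L w i j = (rho w i j : L) := rfl

/-- The transvection by which the second handle is twisted. -/
def twist (t : L) : SL(2, L) := ⟨!![1, t; 0, 1], by simp⟩

theorem coe_twist (t : L) : (twist t : Matrix (Fin 2) (Fin 2) L) = !![1, t; 0, 1] := rfl

theorem twist_inv (t : L) : (twist t)⁻¹ = twist (-t) := by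
  apply inv_eq_of_mul_eq_one_right
  ext i j
  rw [Matrix.SpecialLinearGroup.coe_mul, coe_twist, coe_twist]
  fin_cases i <;> fin_cases j <;> simp

theorem twist_mul (t : L) (M : SL(2, L)) (j : Fin 2) :
    (twist t * M) 0 j = M 0 j + t * M 1 j ∧ (twist t * M) 1 j = M 1 j := by
  rw [Matrix.SpecialLinearGroup.coe_mul, coe_twist]
  simp [mul_apply, Fin.sum_univ_two]

/-- The representation of the second handle. -/
def rightRep (t : L) : FreeGroup (Fin 2) →* SL(2, L) :=
  (MulAut.conj (twist t)).toMonoidHom.comp (leftRep L)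

theorem rightRep_apply (t : L) (w : FreeGroup (Fin 2)) :
    rightRep t w = twist t * (leftRep L w * twist (-t)) := by
  rw [← twist_inv, ← mul_assoc]; rfl

/-- The image of the commutator is upper triangular with equal diagonal entries, so it commutes with
the transvection. -/
theorem rightRep_comm (t : L) : rightRep t commXY = leftRep L commXY := by
  rw [rightRep_apply, ← twist_inv, ← mul_assoc, mul_inv_eq_iff_eq_mul]
  ext i j
  simp only [Matrix.SpecialLinearGroup.coe_mul, mul_apply, Fin.sum_univ_two, leftRep_apply,
    rho_comm]
  fin_cases i <;> fin_cases j <;> simp [coe_twist, add_comm]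

/-- The representation of the surface group of genus two. -/
def rep (t : L) : SurfaceGroup 2 →* SL(2, L) :=
  SurfaceGroup.lift ![leftRep L (FreeGroup.of 0), rightRep t (FreeGroup.of 1)]
    ![leftRep L (FreeGroup.of 1), rightRep t (FreeGroup.of 0)] (by
      have h := (rightRep_comm t).symm
      rw [← mul_inv_eq_one] at h
      simpa [commutatorProd, commXY, mul_assoc] using h)

theorem rep_leftHandle (t : L) (w : FreeGroup (Fin 2)) : rep t (leftHandle w) = leftRep L w := by
  have h : (rep t).comp leftHandle = leftRep L := by
    ext1 i
    fin_cases i <;> simp [rep, leftHandle]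
  exact DFunLike.congr_fun h w

theorem rep_rightHandle (t : L) (w : FreeGroup (Fin 2)) :
    rep t (rightHandle w) = rightRep t w := by
  have h : (rep t).comp rightHandle = rightRep t := by
    ext1 i
    fin_cases i <;> simp [rep, rightHandle]
  exact DFunLike.congr_fun h w

variable {Γ : Type*} [LinearOrderedCommGroupWithZero Γ] (ν : Valuation L Γ)

/-- The vectors whose second coordinate is at least as large as the first one. -/
def Low (X Y : L) : Prop := ν X ≤ ν Y ∧ 1 ≤ ν Y

/-- The vectors whose first coordinate is larger than the second one. -/
def High (X Y : L) : Prop := ν Y < ν X ∧ 1 < ν X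

variable {ν}

/-- Here s * Y strictly dominates X, so there is no cancellation. -/
theorem Low.high {X Y s : L} (h : Low ν X Y) (hs : 1 < ν s) : High ν (X + s * Y) Y := by
  have h0 : 0 < ν Y := zero_lt_one.trans_le h.2
  have h1 : ν Y < ν (s * Y) := by
    rw [map_mul]
    exact lt_mul_of_one_lt_left h0 hs
  have h2 : ν (X + s * Y) = ν (s * Y) := ν.map_add_eq_of_lt_right (h.1.trans_lt h1)
  exact ⟨h2 ▸ h1, h2 ▸ h.2.trans_lt h1⟩

theorem valuation_intCast_le (hν : ∀ n : ℤ, n ≠ 0 → ν (n : L) = 1) (n : ℤ) : ν (n : L) ≤ 1 := by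
  rcases eq_or_ne n 0 with rfl | hn
  · simp
  · exact (hν n hn).le

/-- Since ν c = 1, the term c * X strictly dominates d * Y, so the new second coordinate has
valuation ν X, which bounds the first. -/
theorem High.low (hν : ∀ n : ℤ, n ≠ 0 → ν (n : L) = 1) {X Y : L} (h : High ν X Y) (a b c d : ℤ)
    (hc : c ≠ 0) : Low ν (a * X + b * Y) (c * X + d * Y) := by
  have hle (n : ℤ) (Z : L) : ν (n * Z) ≤ ν Z := by
    rw [map_mul]
    exact mul_le_of_le_one_left' (valuation_intCast_le hν n)
  have h1 : ν (c * X) = ν X := by rw [map_mul, hν c hc, one_mul]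
  have h2 : ν (c * X + d * Y) = ν X := by
    rw [← h1]
    exact ν.map_add_eq_of_lt_left (h1.symm ▸ (hle d Y).trans_lt h.1)
  refine ⟨?_, h2 ▸ h.2.le⟩
  rw [h2]
  exact ν.map_add_le (hle a X) ((hle b Y).trans h.1.le)

theorem leftRep_mul (w : FreeGroup (Fin 2)) (M : SL(2, L)) (i j : Fin 2) :
    (leftRep L w * M) i j = rho w i 0 * M 0 j + rho w i 1 * M 1 j := by
  simp [mul_apply, Fin.sum_univ_two, leftRep_apply]

theorem low_leftRep_mul (hν : ∀ n : ℤ, n ≠ 0 → ν (n : L) = 1) {M : SL(2, L)}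
    (hM : High ν (M 0 1) (M 1 1)) {w : FreeGroup (Fin 2)} (hw : rho w 1 0 ≠ 0) :
    Low ν ((leftRep L w * M) 0 1) ((leftRep L w * M) 1 1) := by
  rw [leftRep_mul, leftRep_mul]
  exact hM.low hν _ _ _ _ hw

theorem high_twist_mul {t : L} (ht : 1 < ν t) {M : SL(2, L)} (hM : Low ν (M 0 1) (M 1 1)) :
    High ν ((twist t * M) 0 1) ((twist t * M) 1 1) := by
  rw [(twist_mul t M 1).1, (twist_mul t M 1).2]
  exact hM.high ht

theorem high_rightRep_mul (hν : ∀ n : ℤ, n ≠ 0 → ν (n : L) = 1) {t : L} (ht : 1 < ν t)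
    {M : SL(2, L)} (hM : Low ν (M 0 1) (M 1 1)) {w : FreeGroup (Fin 2)} (hw : rho w 1 0 ≠ 0) :
    High ν ((rightRep t w * M) 0 1) ((rightRep t w * M) 1 1) := by
  rw [rightRep_apply, mul_assoc, mul_assoc]
  exact high_twist_mul ht (low_leftRep_mul hν
    (high_twist_mul (by rwa [Valuation.map_neg]) hM) hw)

theorem Alternating.high (hν : ∀ n : ℤ, n ≠ 0 → ν (n : L) = 1) {t : L} (ht : 1 < ν t)
    {h : SurfaceGroup 2} (hh : Alternating h) : High ν (rep t h 0 1) (rep t h 1 1) := by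
  induction hh with
  | base v hv =>
    -- The second column of the identity is (0, 1), the starting vector of the ping-pong.
    have h1 : Low ν ((1 : SL(2, L)) 0 1) ((1 : SL(2, L)) 1 1) := by simp [Low]
    simpa only [rep_rightHandle, mul_one] using high_rightRep_mul hν ht h1 hv
  | step v u h hv hu hh ih =>
    rw [map_mul, map_mul, rep_rightHandle, rep_leftHandle, mul_assoc]
    exact high_rightRep_mul hν ht (low_leftRep_mul hν ih hu) hv

theorem leftRep_injective [CharZero L] : Function.Injective (leftRep L) := by
  intro u v h
  apply rho_injective
  ext i j
  have := congrArg (fun M : SL(2, L) => M i j) h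
  simpa only [leftRep_apply, Int.cast_inj] using this

/-- The representation is faithful if the twist is larger than all integers. -/
theorem rep_injective [CharZero L] (hν : ∀ n : ℤ, n ≠ 0 → ν (n : L) = 1) {t : L} (ht : 1 < ν t) :
    Function.Injective (rep t) := by
  rw [injective_iff_map_eq_one]
  intro x hx
  rcases reduced x with ⟨u, rfl⟩ | ⟨u, h, u', hh, rfl⟩
  · rw [rep_leftHandle] at hx
    rw [leftRep_injective (hx.trans (map_one _).symm), map_one]
  · exfalso
    -- The padding lies in the first handle, so h would act by an integer matrix, with entries of
    -- valuation at most 1.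
    have h1 : rep t h = leftRep L (u⁻¹ * u'⁻¹) := by
      rw [map_mul, map_mul, rep_leftHandle, rep_leftHandle, mul_eq_one_iff_eq_inv,
        ← eq_inv_mul_iff_mul_eq] at hx
      rw [hx, map_mul, map_inv, map_inv]
    have h2 := (hh.high hν ht).2
    rw [h1, leftRep_apply] at h2
    exact h2.not_ge (valuation_intCast_le hν _)

end Representation

/-- The surface group of genus two embeds into `SL(2, ℚ(t))`. -/
theorem exists_faithful_rep :
    ∃ f : SurfaceGroup 2 →* SL(2, RatFunc ℚ), Function.Injective f := by
  classical
  refine ⟨rep RatFunc.X, rep_injective (ν := RatFunc.inftyValuation ℚ) (fun n hn => ?_) ?_⟩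
  · have h : (n : RatFunc ℚ) = RatFunc.C (n : ℚ) := by simp
    rw [h]
    exact RatFunc.inftyValuation.C ℚ (Int.cast_ne_zero.2 hn)
  · rw [RatFunc.inftyValuation.X, ← WithZero.exp_zero]
    exact WithZero.exp_lt_exp.2 one_pos

end GenusTwo

/-! ### Surface groups of higher genus embed into the surface group of genus two

The surface of genus `m + 2` is the cyclic cover of degree `m + 1` of the surface of genus two. -/

theorem commutatorProd_succ_last {G : Type*} [Group G] {g : ℕ} (A B : Fin (g + 1) → G) :
    commutatorProd A B = commutatorProd (fun i => A i.castSucc) (fun i => B i.castSucc) *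
      (A (Fin.last g) * B (Fin.last g) * (A (Fin.last g))⁻¹ * (B (Fin.last g))⁻¹) := by
  simp only [commutatorProd, List.ofFn_succ', List.concat_eq_append, List.prod_append,
    List.prod_singleton]

/-- The relation gives [u, v] = [b, a], and the conjugates of [b, a] by successive powers of a
telescope. -/
theorem commutatorProd_conj_pow {G : Type*} [Group G] {a b u v : G}
    (h : a * b * a⁻¹ * b⁻¹ * (u * v * u⁻¹ * v⁻¹) = 1) (n : ℕ) :
    commutatorProd (fun k : Fin n => a ^ (k : ℕ) * u * (a ^ (k : ℕ))⁻¹)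
      (fun k => a ^ (k : ℕ) * v * (a ^ (k : ℕ))⁻¹) = b * a ^ n * b⁻¹ * (a ^ n)⁻¹ := by
  induction n with
  | zero => simp [commutatorProd]
  | succ n ih =>
    have hc : u * v * u⁻¹ * v⁻¹ = b * a * b⁻¹ * a⁻¹ := by
      rw [eq_inv_of_mul_eq_one_right h]; group
    rw [commutatorProd_succ_last]
    simp only [Fin.val_castSucc, Fin.val_last]
    rw [ih]
    calc _ = b * a ^ n * b⁻¹ * (a ^ n)⁻¹ * (a ^ n * (u * v * u⁻¹ * v⁻¹) * (a ^ n)⁻¹) := by group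
      _ = _ := by rw [hc, pow_succ]; group

namespace CyclicCover

open SurfaceGroup

variable {m : ℕ}

theorem genusTwo_relation : a 0 * b 0 * (a 0)⁻¹ * (b 0)⁻¹ *
    (a 1 * b 1 * (a 1)⁻¹ * (b 1)⁻¹) = (1 : SurfaceGroup 2) := by
  have h := commutatorProd_a_b (g := 2)
  simp only [commutatorProd, List.ofFn_succ, List.ofFn_zero, List.prod_cons, List.prod_nil,
    mul_one] at h
  exact h

/-- The map of surface groups that the cyclic cover of degree `m + 1` induces. -/
def coverHom (m : ℕ) : SurfaceGroup (m + 2) →* SurfaceGroup 2 :=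
  SurfaceGroup.lift
    (Fin.cons (a 0 ^ (m + 1)) fun k : Fin (m + 1) => a 0 ^ (k : ℕ) * a 1 * (a 0 ^ (k : ℕ))⁻¹)
    (Fin.cons (b 0) fun k : Fin (m + 1) => a 0 ^ (k : ℕ) * b 1 * (a 0 ^ (k : ℕ))⁻¹)
    (by
      rw [commutatorProd_succ]
      simp only [Fin.cons_zero, Fin.cons_succ]
      rw [commutatorProd_conj_pow genusTwo_relation]
      group)

/-! ### Permutations of the sheets. -/

section Monodromy

variable {G : Type*} [Group G]

/-- Left multiplication by an element that depends on the sheet. -/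
def sheetHom (m : ℕ) (G : Type*) [Group G] :
    (Fin (m + 1) → G) →* Equiv.Perm (G × Fin (m + 1)) where
  toFun f :=
    { toFun := fun x => (f x.2 * x.1, x.2)
      invFun := fun x => ((f x.2)⁻¹ * x.1, x.2)
      left_inv := fun x => by simp
      right_inv := fun x => by simp }
  map_one' := by ext x <;> simp
  map_mul' f h := by ext x <;> simp [mul_assoc]

theorem sheetHom_apply (f : Fin (m + 1) → G) (x : G) (k : Fin (m + 1)) :
    sheetHom m G f (x, k) = (f k * x, k) := rfl

theorem add_one_eq_zero_iff (k : Fin (m + 1)) : k + 1 = 0 ↔ k = Fin.last m := by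
  rw [← Fin.last_add_one, add_left_inj]

theorem neg_one_eq_last : (-1 : Fin (m + 1)) = Fin.last m :=
  (add_one_eq_zero_iff _).1 (neg_add_cancel 1)

/-- The passage from each sheet to the next one, with a multiplication on the way from the last
sheet to the first one. -/
def shift (m : ℕ) (α : G) : Equiv.Perm (G × Fin (m + 1)) where
  toFun x := (if x.2 = Fin.last m then α⁻¹ * x.1 else x.1, x.2 + 1)
  invFun x := (if x.2 = 0 then α * x.1 else x.1, x.2 - 1)
  left_inv := by
    rintro ⟨x, k⟩
    by_cases hk : k = Fin.last m
    · simp [hk, neg_one_eq_last]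
    · simp [add_one_eq_zero_iff, hk]
  right_inv := by
    rintro ⟨x, k⟩
    by_cases hk : k = 0
    · simp [hk, neg_one_eq_last]
    · simp [hk, ← add_one_eq_zero_iff]

theorem shift_of_ne (α x : G) {k : Fin (m + 1)} (hk : k ≠ Fin.last m) :
    shift m α (x, k) = (x, k + 1) := by simp [shift, hk]

theorem shift_last (α x : G) : shift m α (x, Fin.last m) = (α⁻¹ * x, 0) := by simp [shift]

theorem shift_pow_zero (α x : G) (k : ℕ) (hk : k < m + 1) :
    (shift m α ^ k) (x, 0) = (x, ⟨k, hk⟩) := by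
  induction k with
  | zero => rfl
  | succ k ih =>
    rw [pow_succ', Equiv.Perm.mul_apply, ih (by omega), shift_of_ne _ _ (by simp [Fin.ext_iff]; omega)]
    congr 1
    ext
    rw [Fin.val_add_one_of_lt (by simp [Fin.lt_def]; omega)]

theorem shift_pow_succ_zero (α x : G) : (shift m α ^ (m + 1)) (x, 0) = (α⁻¹ * x, 0) := by
  rw [pow_succ', Equiv.Perm.mul_apply, shift_pow_zero _ _ _ (by omega)]
  exact shift_last α x

/-- The relation that the monodromy satisfies. -/
theorem sheetHom_mul_shift {α : G} {β c : Fin (m + 1) → G}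
    (hβ : ∀ k, k ≠ Fin.last m → β (k + 1) = (c k)⁻¹ * β k)
    (hlast : β 0 * α⁻¹ = α⁻¹ * ((c (Fin.last m))⁻¹ * β (Fin.last m))) :
    sheetHom m G β * shift m α = shift m α * sheetHom m G (c⁻¹ * β) := by
  ext1 ⟨x, k⟩
  rw [Equiv.Perm.mul_apply, Equiv.Perm.mul_apply]
  by_cases hk : k = Fin.last m
  · subst hk
    rw [shift_last, sheetHom_apply, sheetHom_apply, shift_last, ← mul_assoc, hlast]
    simp only [Pi.mul_apply, Pi.inv_apply, mul_assoc]
  · rw [shift_of_ne _ _ hk, sheetHom_apply, sheetHom_apply, shift_of_ne _ _ hk, hβ k hk]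
    rfl

end Monodromy

/-- The commutators of the handles of the cover. -/
def handleComm (k : Fin (m + 1)) : SurfaceGroup (m + 2) :=
  a k.succ * b k.succ * (a k.succ)⁻¹ * (b k.succ)⁻¹

/-- The lifts of the second generator. -/
def sheetB (k : Fin (m + 1)) : SurfaceGroup (m + 2) :=
  -- The solution of β(k + 1) = c(k)⁻¹ β(k) with β(0) = b 0, as the genus two relation demands on
  -- each sheet.
  (Fin.partialProd handleComm k.castSucc)⁻¹ * b 0

theorem sheetB_zero : sheetB (0 : Fin (m + 1)) = b 0 := by simp [sheetB]

/-- The surface relation of genus m + 2 is what closes the recursion for `sheetB` from the last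
sheet back to the first. -/
theorem partialProd_last : Fin.partialProd handleComm (Fin.last (m + 1)) =
    b 0 * a 0 * (b 0)⁻¹ * (a (0 : Fin (m + 2)))⁻¹ := by
  have h := commutatorProd_a_b (g := m + 2)
  rw [commutatorProd_succ] at h
  have h' : Fin.partialProd handleComm (Fin.last (m + 1)) =
      commutatorProd (fun i : Fin (m + 1) => a i.succ) (fun i => b i.succ) := by
    unfold Fin.partialProd commutatorProd
    rw [Fin.val_last, List.take_of_length_le (by simp)]
    rfl
  rw [h', eq_inv_of_mul_eq_one_right h]
  group

/-- The action of the surface group of genus two on the sheets of the cover. -/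
def monodromy (m : ℕ) :
    SurfaceGroup 2 →* Equiv.Perm (SurfaceGroup (m + 2) × Fin (m + 1)) :=
  SurfaceGroup.lift
    -- The shift is inverted so that conjugating by the k-th power of a 0 moves sheet 0 to sheet k,
    -- acts there, and returns.
    ![(shift m (a 0))⁻¹, sheetHom m _ fun k => a k.succ]
    ![sheetHom m _ sheetB, sheetHom m _ fun k => b k.succ]
    (by
      have h := sheetHom_mul_shift (m := m) (α := a 0) (β := sheetB) (c := handleComm)
        (fun k hk => by
          have hk' : (k + 1).castSucc = k.succ := by
            ext
            simp [Fin.val_add_one_of_lt (Fin.lt_last_iff_ne_last.2 hk)]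
          rw [sheetB, hk', Fin.partialProd_succ, sheetB]
          group)
        (by
          have h1 := Fin.partialProd_succ (handleComm (m := m)) (Fin.last m)
          rw [Fin.succ_last, partialProd_last] at h1
          rw [sheetB_zero, sheetB, ← mul_assoc (handleComm _)⁻¹, ← mul_inv_rev, ← h1]
          group)
      have hc : (handleComm : Fin (m + 1) → SurfaceGroup (m + 2)) =
          (fun k => a k.succ) * (fun k => b k.succ) * (fun k => a k.succ)⁻¹ *
            (fun k => b k.succ)⁻¹ := rfl
      have h2 : (shift m (a 0))⁻¹ * sheetHom m _ sheetB * shift m (a 0) * (sheetHom m _ sheetB)⁻¹ *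
          sheetHom m (SurfaceGroup (m + 2)) handleComm = 1 := by
        rw [mul_assoc _ (sheetHom m _ sheetB), h, inv_mul_cancel_left, ← map_inv, ← map_mul,
          ← map_mul]
        simp
      rw [hc, map_mul, map_mul, map_mul, map_inv, map_inv] at h2
      simpa [commutatorProd, mul_assoc] using h2)

/-- On the first sheet, the cover acts by left multiplication. -/
theorem monodromy_coverHom (x y : SurfaceGroup (m + 2)) :
    monodromy m (coverHom m x) (y, 0) = (x * y, 0) := by
  let K : Subgroup (SurfaceGroup (m + 2)) :=
    { carrier := {x | ∀ y, monodromy m (coverHom m x) (y, 0) = (x * y, 0)}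
      mul_mem' := fun {x x'} hx hx' y => by
        rw [map_mul, map_mul, Equiv.Perm.mul_apply, hx', hx, mul_assoc]
      one_mem' := fun y => by simp
      inv_mem' := fun {x} hx y => by
        rw [map_inv, map_inv, Equiv.Perm.inv_eq_iff_eq, hx, mul_inv_cancel_left] }
  have conj (k : Fin (m + 1)) (f : Fin (m + 1) → SurfaceGroup (m + 2)) (y) :
      ((shift m (a 0))⁻¹ ^ (k : ℕ) * sheetHom m _ f * ((shift m (a 0))⁻¹ ^ (k : ℕ))⁻¹ :
        Equiv.Perm (SurfaceGroup (m + 2) × Fin (m + 1))) (y, 0) =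
        (f k * y, 0) := by
    rw [inv_pow, inv_inv, Equiv.Perm.mul_apply, Equiv.Perm.mul_apply, shift_pow_zero _ _ _ k.2,
      sheetHom_apply, Equiv.Perm.inv_eq_iff_eq, shift_pow_zero _ _ _ k.2]
  have hK : Subgroup.closure (Set.range PresentedGroup.of) ≤ K := by
    rw [Subgroup.closure_le]
    rintro _ ⟨i | i, rfl⟩ y
    · change monodromy m (coverHom m (a i)) (y, 0) = (a i * y, 0)
      refine Fin.cases ?_ (fun k => ?_) i
      · rw [coverHom, lift_a, Fin.cons_zero, map_pow, monodromy, lift_a]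
        simp only [Matrix.cons_val_zero, inv_pow]
        rw [Equiv.Perm.inv_eq_iff_eq, shift_pow_succ_zero, inv_mul_cancel_left]
      · rw [coverHom, lift_a, Fin.cons_succ, map_mul, map_mul, map_inv, map_pow, monodromy, lift_a,
          lift_a]
        exact conj k _ y
    · change monodromy m (coverHom m (b i)) (y, 0) = (b i * y, 0)
      refine Fin.cases ?_ (fun k => ?_) i
      · rw [coverHom, lift_b, Fin.cons_zero, monodromy, lift_b]
        simp only [Matrix.cons_val_zero]
        rw [sheetHom_apply, sheetB_zero]
      · rw [coverHom, lift_b, Fin.cons_succ, map_mul, map_mul, map_inv, map_pow, monodromy, lift_a,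
          lift_b]
        exact conj k _ y
  rw [PresentedGroup.closure_range_of] at hK
  exact hK (Subgroup.mem_top x) y

/-- Evaluating the action at (1, 0) recovers x. -/
theorem coverHom_injective : Function.Injective (coverHom m) := by
  intro x x' h
  have h1 := monodromy_coverHom x 1
  rw [h, monodromy_coverHom] at h1
  simpa using (congrArg Prod.fst h1).symm

end CyclicCover

/-! ### Linearity of the extensions -/

/-- A faithful representation by matrices over any field makes a group linear. -/
theorem isLinearGroup_of_injective.{u} {G : Type u} [Group G] {ι : Type*} [Fintype ι]
    [DecidableEq ι] [Nonempty ι] {K : Type} [Field K] (f : G →* Matrix ι ι K)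
    (hf : Function.Injective f) : IsLinearGroup G := by
  -- `IsLinearGroup` asks for a field in the universe of G, hence the `ULift`.
  let e : Matrix ι ι K ≃+* Matrix (Fin (Fintype.card ι)) (Fin (Fintype.card ι)) (ULift.{u} K) :=
    (ULift.ringEquiv.{0, u} (R := K)).symm.mapMatrix.trans
      (Matrix.reindexAlgEquiv ℤ (ULift.{u} K) (Fintype.equivFin ι)).toRingEquiv
  refine ⟨ULift.{u} K, inferInstance, Fintype.card ι,
    ((e : Matrix ι ι K →* _).comp f).toHomUnits, Fintype.card_pos, fun x y h => hf ?_⟩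
  exact e.injective (congrArg Units.val h)

/-- The block diagonal sum of two representations. -/
def blockSum {G ι κ K : Type*} [Group G] [Fintype ι] [DecidableEq ι] [Fintype κ] [DecidableEq κ]
    [Field K] (f : G →* Matrix ι ι K) (h : G →* Matrix κ κ K) : G →* Matrix (ι ⊕ κ) (ι ⊕ κ) K where
  toFun x := Matrix.fromBlocks (f x) 0 0 (h x)
  map_one' := by simp
  map_mul' x y := by simp [Matrix.fromBlocks_multiply]

/-- Surface groups of genus at least two embed into `SL(2, ℚ(t))`. -/
theorem SurfaceGroup.exists_faithful_rep {g : ℕ} (hg : 2 ≤ g) :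
    ∃ f : SurfaceGroup g →* Matrix (Fin 2) (Fin 2) (RatFunc ℚ), Function.Injective f := by
  obtain ⟨m, rfl⟩ := Nat.exists_eq_add_of_le' hg
  obtain ⟨f, hf⟩ := GenusTwo.exists_faithful_rep
  exact ⟨Matrix.SpecialLinearGroup.coeMonoidHom.comp (f.comp (CyclicCover.coverHom m)),
    Subtype.val_injective.comp (hf.comp CyclicCover.coverHom_injective)⟩

/-- An extension of the trivial surface group is the kernel. -/
theorem GroupExtension.inl_surjective_of_genus_zero {E : Type*} [Group E]
    (S : GroupExtension (Multiplicative ℤ) E (SurfaceGroup 0)) : Function.Surjective S.inl := by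
  intro e
  have h : MonoidHom.id (SurfaceGroup 0) = 1 :=
    SurfaceGroup.hom_ext (fun i => i.elim0) (fun i => i.elim0)
  have he : e ∈ S.inl.range := by
    rw [S.range_inl_eq_ker_rightHom]
    exact DFunLike.congr_fun h (S.rightHom e)
  exact he

/-- Central extensions of surface groups by `ℤ` are linear. -/
theorem GroupExtension.isLinearGroup {g : ℕ} {E : Type*} [Group E]
    (S : GroupExtension (Multiplicative ℤ) E (SurfaceGroup g))
    (hS : S.inl.range ≤ Subgroup.center E) : IsLinearGroup E := by
  rcases Nat.eq_zero_or_pos g with rfl | hg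
  · let e := MulEquiv.ofBijective S.inl ⟨S.inl_injective, S.inl_surjective_of_genus_zero⟩
    exact isLinearGroup_of_injective
      (((HeisenbergType.Model.toMatrix 0 ℚ).comp (HeisenbergType.Model.central 0)).comp
        e.symm.toMonoidHom)
      ((HeisenbergType.Model.toMatrix_injective.comp
        HeisenbergType.Model.central_injective).comp e.symm.injective)
  choose A hA using fun i => S.rightHom_surjective (SurfaceGroup.a i)
  choose B hB using fun i => S.rightHom_surjective (SurfaceGroup.b i)
  obtain ⟨p, hp⟩ := S.exists_commutatorProd_eq_zpow hA hB
  obtain ⟨e, -⟩ := S.exists_quotient_equiv hS hA hB hp hg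
  have hinj := S.prod_injective hS hA hB
  let h : E →* Matrix (Fin 4) (Fin 4) (RatFunc ℚ) :=
    ((HeisenbergType.Model.toMatrix p _).comp
      ((HeisenbergType.toModel p).comp e.toMonoidHom)).comp (QuotientGroup.mk' (tailClosure A B))
  have hh {x y : E} (hxy : h x = h y) : QuotientGroup.mk' (tailClosure A B) x =
      QuotientGroup.mk' (tailClosure A B) y :=
    ((HeisenbergType.Model.toMatrix_injective.comp HeisenbergType.toModel_injective).comp
      e.injective) hxy
  rcases Nat.lt_or_ge g 2 with hg2 | hg2
  -- Genus one: N is trivial, so the Heisenberg representation is already faithful on G.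
  · refine isLinearGroup_of_injective h fun x y hxy => ?_
    have hxy' := QuotientGroup.eq.1 (hh hxy)
    rwa [GroupExtension.tailClosure_eq_bot (by omega), Subgroup.mem_bot, inv_mul_eq_one] at hxy'
  · obtain ⟨f, hf⟩ := SurfaceGroup.exists_faithful_rep hg2
    refine isLinearGroup_of_injective (blockSum (f.comp S.rightHom) h) fun x y hxy => hinj ?_
    obtain ⟨h1, -, -, h2⟩ := Matrix.fromBlocks_inj.1 hxy
    exact Prod.ext (hf h1) (hh h2)

theorem mainTheorem5 (g : ℕ) {E : Type*} [Group E]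
    (S : GroupExtension (Multiplicative ℤ) E (SurfaceGroup g))
    (hS : S.inl.range ≤ Subgroup.center E) :
    IsLinearGroup E ∧
    ∀ A B : Fin g → E,
      (∀ i, S.rightHom (A i) = SurfaceGroup.a i) →
      (∀ i, S.rightHom (B i) = SurfaceGroup.b i) →
      Group.IsNilpotent (E ⧸ tailClosure A B) ∧
      Function.Injective (S.rightHom.prod (QuotientGroup.mk' (tailClosure A B))) ∧
      ∃ p : ℤ,
        commutatorProd A B = S.inl (Multiplicative.ofAdd 1) ^ p ∧
        ∀ hg : 0 < g, ∃ e : E ⧸ tailClosure A B ≃* HeisenbergType p,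
          e (QuotientGroup.mk (A ⟨0, hg⟩)) = PresentedGroup.of 0 ∧
          e (QuotientGroup.mk (B ⟨0, hg⟩)) = PresentedGroup.of 1 ∧
          e (QuotientGroup.mk (S.inl (Multiplicative.ofAdd 1))) = PresentedGroup.of 2 := by
  refine ⟨S.isLinearGroup hS, fun A B hA hB => ?_⟩
  obtain ⟨p, hp⟩ := S.exists_commutatorProd_eq_zpow hA hB
  refine ⟨?_, S.prod_injective hS hA hB, p, hp, S.exists_quotient_equiv hS hA hB hp⟩
  rcases Nat.eq_zero_or_pos g with rfl | hg
  · have : Group.IsNilpotent E :=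
      Group.nilpotent_of_surjective S.inl S.inl_surjective_of_genus_zero
    infer_instance
  · obtain ⟨e, -⟩ := S.exists_quotient_equiv hS hA hB hp hg
    exact Group.nilpotent_of_mulEquiv e.symm
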